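/- Consider the pure $\lambda$-terms $t,u,s ::= v \mid tu$ with values $v ::= x \mid \lambda x.t$, up to renaming of bound variables, and the balanced contexts $B ::= \langle\cdot\rangle \mid (\lambda x.B)t \mid Bt \mid tB$. A balanced $\beta_v$-step $\to_{\beta_v^\flat}$ is the closure under balanced contexts of $(\lambda x.t)v \mapsto t\{v/x\}$ ($v$ a value). A balanced $\sigma$-step is the closure under balanced contexts of $(\lambda x.t)us \mapsto (\lambda x.ts)u$ ($x$ not free in $s$) and $v((\lambda x.s)u) \mapsto (\lambda x.vs)u$ ($v$ a value, $x$ not free in $v$). Balanced shuffling reduction $\to_{\mathsf{sh}^\flat}$ is the union of the two. Let $\mathrm{leng}_{\beta_v}(t) \in \mathbb{N}\cup\{\infty\}$ be the number of balanced $\beta_v$-steps in a $\to_{\mathsf{sh}^\flat}$-reduction sequence from $t$ to a $\to_{\mathsf{sh}^\flat}$-normal form (the same number for all such sequences), and $\infty$ if there is no such sequence. Negative types $P \multimap Q$ and positive types $P,Q ::= [N_1,\dots,N_n]$ (finite multisets of negative types, $n\ge 0$; $\mathbf{0}$ is the empty multiset) are defined by mutual induction. Environments $\Gamma$ map variables to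 positive types, with value $\mathbf{0}$ at all but finitely many variables, and are added pointwise by multiset sum $\uplus$. Derivations are generated by the rules: (ax) $x:P \vdash x:P$; (@) from $\Gamma\vdash t:[P\multimap Q]$ and $\Gamma'\vdash u:P$ infer $\Gamma\uplus\Gamma'\vdash tu:Q$; ($\lambda$) for any $n\ge 0$, from $\Gamma_i,x:P_i\vdash t:Q_i$ ($1\le i\le n$) infer $\Gamma_1\uplus\dots\uplus\Gamma_n\vdash\lambda x.t:[P_1\multimap Q_1,\dots,P_n\multimap Q_n]$. The size $|\pi|$ of a derivation $\pi$ is its number of @ rules. Theorem. Let $t$ be a closed term that is normalizable for balanced $\beta_v$-reduction $\to_{\beta_v^\flat}$. Then there is a derivation of $\vdash t:\mathbf{0}$ (empty environment, empty type), and every derivation $\pi$ of $\vdash t:\mathbf{0}$ satisfies $\mathrm{leng}_{\beta_v}(t)=|\pi|$. More explicitly, every $\to_{\mathsf{sh}^\flat}$-reduction sequence from $t$ to a $\to_{\mathsf{sh}^\flat}$-normal form contains exactly $|\pi|$ balanced $\beta_v$-steps, and every $\to_{\beta_v^\flat}$-reduction sequence from $t$ to a $\to_{\beta_v^\flat}$-normal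 form has exactly $|\pi|$ steps. -/

import Mathlib

namespace CbV

/-! ### Terms, up to renaming of bound variables (de Bruijn indices) -/

inductive Tm : Type
  | var : ℕ → Tm
  | app : Tm → Tm → Tm
  | lam : Tm → Tm

namespace Tm

def freeVars : Tm → Set ℕ
  | var x => {x}
  | app t u => freeVars t ∪ freeVars u
  | lam t => {x | x + 1 ∈ freeVars t}

def Closed (t : Tm) : Prop := t.freeVars = ∅

/-- Values are the variables and the abstractions. -/
inductive IsValue : Tm → Prop
  | var (x : ℕ) : IsValue (var x)
  | lam (t : Tm) : IsValue (lam t)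

/-- Lifting of a renaming under a binder. -/
def upRen (ρ : ℕ → ℕ) : ℕ → ℕ
  | 0 => 0
  | n + 1 => ρ n + 1

def rename : (ℕ → ℕ) → Tm → Tm
  | ρ, var x => var (ρ x)
  | ρ, app t u => app (rename ρ t) (rename ρ u)
  | ρ, lam t => lam (rename (upRen ρ) t)

/-- `shift t` is `t` seen under one more binder, which binds no variable of `t`. -/
def shift (t : Tm) : Tm := rename Nat.succ t

/-- Lifting of a simultaneous substitution under a binder. -/
def upSubst (σ : ℕ → Tm) : ℕ → Tm
  | 0 => var 0
  | n + 1 => shift (σ n)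

/-- Capture-avoiding simultaneous substitution. -/
def subst : (ℕ → Tm) → Tm → Tm
  | σ, var x => σ x
  | σ, app t u => app (subst σ t) (subst σ u)
  | σ, lam t => lam (subst (upSubst σ) t)

/-- `inst t v` is `t{v/x}`, where `x` is the variable bound by the abstraction `lam t`. -/
def inst (t v : Tm) : Tm :=
  subst (fun | 0 => v | n + 1 => var n) t

end Tm

open Tm

/-! ### Balanced contexts and reductions -/

/-- Balanced contexts `B ::= ⟨·⟩ | (λx.B)t | Bt | tB`. -/
inductive BCtx : Type
  | hole : BCtx
  | lamApp : BCtx → Tm → BCtx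
  | appL : BCtx → Tm → BCtx
  | appR : Tm → BCtx → BCtx

/-- Capture-allowing substitution of a term for the hole. -/
def BCtx.fill : BCtx → Tm → Tm
  | hole, s => s
  | lamApp B t, s => app (lam (B.fill s)) t
  | appL B t, s => app (B.fill s) t
  | appR t B, s => app t (B.fill s)

/-- Root-step `(λx.t)v ↦ t{v/x}`, for `v` a value. -/
inductive RootBetaV : Tm → Tm → Prop
  | mk (t v : Tm) : IsValue v → RootBetaV (app (lam t) v) (inst t v)

/-- Root-steps `(λx.t)us ↦ (λx.ts)u` for `x` not free in `s`, and
`v((λx.s)u) ↦ (λx.vs)u` for `v` a value and `x` not free in `v`.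
The shifts account for the side conditions on `x`. -/
inductive RootSigma : Tm → Tm → Prop
  | sigma1 (t u s : Tm) :
      RootSigma (app (app (lam t) u) s) (app (lam (app t (shift s))) u)
  | sigma3 (v s u : Tm) : IsValue v →
      RootSigma (app v (app (lam s) u)) (app (lam (app (shift v) s)) u)

/-- Closure of a root-step rule under balanced contexts. -/
def Bal (R : Tm → Tm → Prop) (t u : Tm) : Prop :=
  ∃ (B : BCtx) (t' u' : Tm), t = B.fill t' ∧ u = B.fill u' ∧ R t' u'

/-- Balanced `βv`-reduction. -/
def BetaV : Tm → Tm → Prop := Bal RootBetaV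

/-- Balanced `σ`-reduction. -/
def Sigma : Tm → Tm → Prop := Bal RootSigma

/-- Balanced shuffling reduction. -/
def Shuf : Tm → Tm → Prop := Bal (fun t u => RootBetaV t u ∨ RootSigma t u)

def Normal (R : Tm → Tm → Prop) (t : Tm) : Prop := ∀ u, ¬ R t u

def Normalizable (R : Tm → Tm → Prop) (t : Tm) : Prop :=
  ∃ u, Relation.ReflTransGen R t u ∧ Normal R u

/-- Reduction sequences of balanced `βv`-steps. -/
inductive BetaVSeq : Tm → Tm → Type
  | nil (t : Tm) : BetaVSeq t t
  | cons {t u s : Tm} : BetaV t u → BetaVSeq u s → BetaVSeq t s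

/-- The number of steps. -/
def BetaVSeq.leng : {t u : Tm} → BetaVSeq t u → ℕ
  | _, _, nil _ => 0
  | _, _, cons _ d => d.leng + 1

/-- Reduction sequences of balanced shuffling steps; each step is a balanced `βv`-step or a balanced
`σ`-step. -/
inductive ShufSeq : Tm → Tm → Type
  | nil (t : Tm) : ShufSeq t t
  | betaV {t u s : Tm} : BetaV t u → ShufSeq u s → ShufSeq t s
  | sigma {t u s : Tm} : Sigma t u → ShufSeq u s → ShufSeq t s

/-- The number of `βv`-steps. -/
def ShufSeq.leng : {t u : Tm} → ShufSeq t u → ℕ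
  | _, _, nil _ => 0
  | _, _, betaV _ d => d.leng + 1
  | _, _, sigma _ d => d.leng

/-- The number of `βv`-steps in the normalizing balanced shuffling reduction sequences from `t`,
and `∞` if there is none. (All these sequences have the same number of `βv`-steps, so the infimum
is that number; for an empty set it is `∞`.) -/
noncomputable def leng (t : Tm) : ℕ∞ :=
  sInf {n : ℕ∞ | ∃ (u : Tm) (d : ShufSeq t u), Normal Shuf u ∧ n = (d.leng : ℕ∞)}

/-! ### Types: negative types `P ⊸ Q`, positive types are finite multisets of negative types -/

/-- The functor whose initial algebra is the set of negative types. -/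
def NegF (X : Type) : Type := Multiset X × Multiset X

instance : Functor NegF where
  map f p := (p.1.map f, p.2.map f)

/-- `NegF` is a quotient of a polynomial functor, so it has an initial algebra. -/
noncomputable instance : QPF NegF where
  P := ⟨ℕ × ℕ, fun a => Fin a.1 ⊕ Fin a.2⟩
  abs := fun x =>
    (Finset.univ.val.map (fun i => x.2 (Sum.inl i)), Finset.univ.val.map (fun i => x.2 (Sum.inr i)))
  repr := fun p => ⟨(p.1.toList.length, p.2.toList.length),
    Sum.elim (fun i => p.1.toList.get i) (fun i => p.2.toList.get i)⟩
  abs_repr := by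
    rintro α ⟨p, q⟩
    have h : ∀ s : Multiset α,
        (Finset.univ.val.map fun i : Fin s.toList.length => s.toList.get i) = s := fun s => by
      rw [Fin.univ_val_map, List.ofFn_get, Multiset.coe_toList]
    exact Prod.ext (h p) (h q)
  abs_map := by
    rintro α β f ⟨a, g⟩
    exact Prod.ext
      (Multiset.map_map f (fun i => g (Sum.inl i)) Finset.univ.val).symm
      (Multiset.map_map f (fun i => g (Sum.inr i)) Finset.univ.val).symm

/-- Negative types: the least solution of `U = M(U) × M(U)`, `M` being finite multisets. -/
def Neg : Type := QPF.Fix NegF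

/-- Positive types. The empty multiset is `0`. -/
abbrev Pos : Type := Multiset Neg

/-- The negative type `P ⊸ Q`. -/
noncomputable def arr (P Q : Pos) : Neg := QPF.Fix.mk ((P, Q) : NegF (QPF.Fix NegF))

theorem arr_inj {P Q P' Q' : Pos} : arr P Q = arr P' Q' ↔ P = P' ∧ Q = Q' := by
  constructor
  · intro h
    have h2 : ((P, Q) : NegF Neg) = (P', Q') :=
      (QPF.Fix.dest_mk _).symm.trans ((congrArg QPF.Fix.dest h).trans (QPF.Fix.dest_mk _))
    exact Prod.mk.inj h2
  · rintro ⟨rfl, rfl⟩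
    rfl

theorem exists_arr (N : Neg) : ∃ P Q, N = arr P Q :=
  ⟨(QPF.Fix.dest N).1, (QPF.Fix.dest N).2, (QPF.Fix.mk_dest N).symm⟩

/-- There are no negative types beyond those built by `⊸` in finitely many steps. -/
theorem Neg.induction {C : Neg → Prop}
    (h : ∀ P Q : Pos, (∀ N ∈ P, C N) → (∀ N ∈ Q, C N) → C (arr P Q)) (N : Neg) : C N := by
  refine QPF.Fix.ind C (fun x hx => ?_) N
  obtain ⟨⟨u₁, u₂⟩, rfl⟩ := hx
  refine h _ _ (fun N hN => ?_) (fun N hN => ?_)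
  · obtain ⟨a, -, rfl⟩ := Multiset.mem_map.1 hN
    exact a.2
  · obtain ⟨a, -, rfl⟩ := Multiset.mem_map.1 hN
    exact a.2

/-! ### Type derivations -/

/-- Environments. The sum of environments is the pointwise sum. -/
abbrev Env : Type := ℕ → Pos

/-- `Γ, x : P`, for `x` the variable of index `0` and the variables of `Γ` shifted. -/
def Env.cons (P : Pos) (Γ : Env) : Env
  | 0 => P
  | n + 1 => Γ n

/-- `Deriv Γ t P` is the type of the derivations of `Γ ⊢ t : P`; the environments of derivable
judgments have finite domain, see `Deriv.finite_dom`. -/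
inductive Deriv : Env → Tm → Pos → Type
  | ax (x : ℕ) (P : Pos) : Deriv (Pi.single x P) (var x) P
  | app {Γ Γ' : Env} {t u : Tm} {P Q : Pos} :
      Deriv Γ t {arr P Q} → Deriv Γ' u P → Deriv (Γ + Γ') (app t u) Q
  | lam (t : Tm) (n : ℕ) (Γ : Fin n → Env) (P Q : Fin n → Pos) :
      (∀ i, Deriv (Env.cons (P i) (Γ i)) t (Q i)) →
      Deriv (∑ i, Γ i) (lam t) (∑ i, {arr (P i) (Q i)})

/-- The number of application rules of a derivation. -/
noncomputable def Deriv.size : {Γ : Env} → {t : Tm} → {P : Pos} → Deriv Γ t P → ℕ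
  | _, _, _, ax _ _ => 0
  | _, _, _, app d e => d.size + e.size + 1
  | _, _, _, lam _ _ _ _ _ d => ∑ i, (d i).size

theorem Deriv.finite_dom {Γ : Env} {t : Tm} {P : Pos} (d : Deriv Γ t P) :
    {x | Γ x ≠ 0}.Finite := by
  induction d with
  | ax x P =>
    refine (Set.finite_singleton x).subset fun y hy => ?_
    by_contra h
    exact hy (by simp [Pi.single_eq_of_ne (show y ≠ x from h)])
  | app d e hd he =>
    refine (hd.union he).subset fun y hy => ?_
    by_contra h
    simp_all
  | lam t n Γ P Q d hd =>
    refine (Set.finite_iUnion fun i => (hd i).preimage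
      (Nat.succ_injective.injOn)).subset fun y hy => ?_
    by_contra h
    apply hy
    simp only [Set.mem_iUnion, Set.mem_preimage, Set.mem_ofPred_eq, not_exists, not_not,
      Nat.succ_eq_add_one, Env.cons] at h
    simp [Finset.sum_apply, h]

end CbV

namespace CbV

open Tm

/-! ### Environments -/

namespace Env

/-! Typing is quantitatively invariant: along a balanced `βv`-step the two sides have the same
judgments, with derivations exactly one @ rule larger on the left, and along a `σ`-step the sizes
agree (`RootBetaV.sameTypings`, `RootSigma.sameTypings`, closed under contexts by
`SameTypings.fill`). The core is the two-way substitution lemma `subst_iff`, which rests on the fact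
that derivations of a value split along multiset sums of types without changing the total size
(`value_zero_iff`, `value_add_iff`).

Existence: a closed `βv`-normal form is an abstraction, which has type `0` with size 0; this
derivation is pulled back to the starting term. Counting: any derivation of `0` in the empty
environment is transported to the end of a normalizing sequence. There the term is a value
(`Normal.isValue_of_derivable`), so the remaining size is 0 and the number of `βv`-steps is the
original size. No confluence argument is needed. -/

theorem cons_succ (P : Pos) (Γ : Env) (n : ℕ) : cons P Γ (n + 1) = Γ n := rfl

theorem cons_inj {P P' : Pos} {Γ Γ' : Env} : cons P Γ = cons P' Γ' ↔ P = P' ∧ Γ = Γ' :=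
  ⟨fun h => ⟨congrFun h 0, funext fun n => congrFun h (n + 1)⟩, by rintro ⟨rfl, rfl⟩; rfl⟩

theorem exists_cons (Γ : Env) : ∃ P Δ, Γ = cons P Δ :=
  ⟨Γ 0, fun n => Γ (n + 1), by funext n; cases n <;> rfl⟩

theorem cons_add (P P' : Pos) (Γ Γ' : Env) :
    cons P Γ + cons P' Γ' = cons (P + P') (Γ + Γ') := by
  funext n; cases n <;> rfl

/-- Removal of the variable of index `k`. -/
def del (k : ℕ) (Γ : Env) : Env := fun x => if x < k then Γ x else Γ (x + 1)

theorem del_zero_cons (P : Pos) (Γ : Env) : del 0 (cons P Γ) = Γ := by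
  funext x; simp [del, cons]

theorem del_succ_cons (k : ℕ) (P : Pos) (Γ : Env) :
    del (k + 1) (cons P Γ) = cons P (del k Γ) := by
  funext x; cases x <;> simp [del, cons]

theorem del_add (k : ℕ) (Γ Γ' : Env) : del k (Γ + Γ') = del k Γ + del k Γ' := by
  funext x; simp only [del, Pi.add_apply]; split <;> rfl

theorem del_zero (k : ℕ) : del k 0 = 0 := by
  funext x; simp [del]

theorem del_single_lt {k x : ℕ} (h : x < k) (P : Pos) :
    del k (Pi.single x P) = Pi.single x P := by
  funext y
  simp only [del, Pi.single_apply]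
  split_ifs <;> first | rfl | omega

theorem del_single_self (k : ℕ) (P : Pos) : del k (Pi.single k P) = 0 := by
  funext y
  simp only [del, Pi.single_apply, Pi.zero_apply]
  split_ifs <;> first | rfl | omega

theorem del_single_succ {k x : ℕ} (h : k ≤ x) (P : Pos) :
    del k (Pi.single (x + 1) P) = Pi.single x P := by
  funext y
  simp only [del, Pi.single_apply]
  split_ifs <;> first | rfl | omega

/-- The environment `Γ` along a renaming `ρ`. -/
noncomputable def ren (ρ : ℕ → ℕ) (Γ : Env) : Env := Function.extend ρ Γ 0

theorem ren_zero (ρ : ℕ → ℕ) : ren ρ 0 = 0 := by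
  classical
  funext y; simp [ren, Function.extend_def]

theorem ren_add (ρ : ℕ → ℕ) (Γ Γ' : Env) : ren ρ (Γ + Γ') = ren ρ Γ + ren ρ Γ' := by
  classical
  funext y
  simp only [ren, Function.extend_def, Pi.add_apply]
  split <;> simp

theorem ren_single {ρ : ℕ → ℕ} (hρ : ρ.Injective) (x : ℕ) (P : Pos) :
    ren ρ (Pi.single x P) = Pi.single (ρ x) P := by
  funext y
  by_cases h : ∃ z, ρ z = y
  · obtain ⟨z, rfl⟩ := h
    simp [ren, hρ.extend_apply, Pi.single_apply, hρ.eq_iff]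
  · have hy : y ≠ ρ x := fun e => h ⟨x, e.symm⟩
    simp [ren, Function.extend_apply' _ _ _ h, hy]

theorem ren_upRen_cons {ρ : ℕ → ℕ} (hρ : ρ.Injective) (hρ' : (upRen ρ).Injective)
    (P : Pos) (Γ : Env) : ren (upRen ρ) (cons P Γ) = cons P (ren ρ Γ) := by
  funext y
  cases y with
  | zero => exact hρ'.extend_apply (cons P Γ) 0 0
  | succ y =>
    by_cases h : ∃ z, ρ z = y
    · obtain ⟨z, rfl⟩ := h
      rw [cons_succ, ren, ren, hρ.extend_apply]
      exact hρ'.extend_apply (cons P Γ) 0 (z + 1)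
    · have h' : ¬ ∃ z, upRen ρ z = y + 1 := by
        rintro ⟨z, hz⟩
        cases z with
        | zero => simp [upRen] at hz
        | succ z => exact h ⟨z, by simpa [upRen] using hz⟩
      rw [cons_succ, ren, ren, Function.extend_apply' _ _ _ h, Function.extend_apply' _ _ _ h']
      rfl

theorem ren_succ (Γ : Env) : ren Nat.succ Γ = cons 0 Γ := by
  funext y
  cases y with
  | zero => exact Function.extend_apply' _ _ _ (by simp)
  | succ y => exact Nat.succ_injective.extend_apply Γ 0 y

end Env

open Env

theorem Tm.upRen_injective {ρ : ℕ → ℕ} (hρ : ρ.Injective) : (upRen ρ).Injective := by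
  intro x y h
  cases x <;> cases y <;> simp_all [upRen, hρ.eq_iff]

/-! ### Derivability with a given size -/

/-- `Derivable Γ t P n` says that `Γ ⊢ t : P` has a derivation of size `n`. The premises of the rule
for abstractions are given one at a time. -/
inductive Derivable : Env → Tm → Pos → ℕ → Prop
  | var (x : ℕ) (P : Pos) : Derivable (Pi.single x P) (var x) P 0
  | app {Γ Γ' : Env} {t u : Tm} {P Q : Pos} {m n : ℕ} :
      Derivable Γ t {arr P Q} m → Derivable Γ' u P n →
      Derivable (Γ + Γ') (app t u) Q (m + n + 1)
  | lam_nil (t : Tm) : Derivable 0 (lam t) 0 0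
  | lam_cons {Γ Γ' : Env} {t : Tm} {P Q R : Pos} {m n : ℕ} :
      Derivable (Env.cons P Γ) t Q m → Derivable Γ' (lam t) R n →
      Derivable (Γ + Γ') (lam t) (arr P Q ::ₘ R) (m + n)

theorem Deriv.derivable {Γ : Env} {t : Tm} {P : Pos} (π : Deriv Γ t P) :
    Derivable Γ t P π.size := by
  induction π with
  | ax x P => exact .var x P
  | app d e hd he => exact .app hd he
  | lam t n Γ P Q d hd =>
    simp only [Deriv.size]
    induction n with
    | zero => simpa using Derivable.lam_nil t
    | succ n ih =>
      have := Derivable.lam_cons (hd 0)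
        (ih (fun i => Γ i.succ) (fun i => P i.succ) (fun i => Q i.succ) (fun i => d i.succ)
          (fun i => hd i.succ))
      simpa [Fin.sum_univ_succ] using this

theorem Derivable.exists_deriv {Γ : Env} {t : Tm} {P : Pos} {n : ℕ} (h : Derivable Γ t P n) :
    ∃ π : Deriv Γ t P, π.size = n := by
  induction h with
  | var x P => exact ⟨.ax x P, rfl⟩
  | app _ _ hd he =>
    obtain ⟨d, rfl⟩ := hd
    obtain ⟨e, rfl⟩ := he
    exact ⟨.app d e, rfl⟩
  | lam_nil t => exact ⟨.lam t 0 Fin.elim0 Fin.elim0 Fin.elim0 (fun i => i.elim0), rfl⟩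
  | @lam_cons Γ Γ' t P Q R m n _ _ hd he =>
    obtain ⟨d, rfl⟩ := hd
    obtain ⟨e, rfl⟩ := he
    cases e with
    | lam _ k Γ' P' Q' e =>
      -- Stated for arbitrary families so that the sums in the indices of `Deriv` can be rewritten;
      -- the families wanted then match definitionally.
      have key : ∀ (G : Fin (k + 1) → Env) (P Q : Fin (k + 1) → Pos)
          (d : ∀ i, Deriv (Env.cons (P i) (G i)) t (Q i)),
          ∃ π : Deriv (G 0 + ∑ i : Fin k, G i.succ) (lam t)
            (arr (P 0) (Q 0) ::ₘ ∑ i : Fin k, {arr (P i.succ) (Q i.succ)}),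
            π.size = (d 0).size + ∑ i : Fin k, (d i.succ).size := by
        intro G P Q d
        rw [← Multiset.singleton_add, ← Fin.sum_univ_succ G,
          ← Fin.sum_univ_succ fun i => ({arr (P i) (Q i)} : Pos),
          ← Fin.sum_univ_succ fun i => (d i).size]
        exact ⟨.lam t (k + 1) G P Q d, rfl⟩
      exact key (Fin.cons Γ Γ') (Fin.cons P P') (Fin.cons Q Q') (Fin.cases d e)

namespace Derivable

theorem var_iff {Γ : Env} {x : ℕ} {P : Pos} {n : ℕ} :
    Derivable Γ (.var x) P n ↔ Γ = Pi.single x P ∧ n = 0 :=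
  ⟨fun h => by cases h; exact ⟨rfl, rfl⟩, by rintro ⟨rfl, rfl⟩; exact .var x P⟩

theorem app_iff {Γ : Env} {t u : Tm} {Q : Pos} {n : ℕ} :
    Derivable Γ (.app t u) Q n ↔ ∃ Γ₁ Γ₂ P n₁ n₂, Derivable Γ₁ t {arr P Q} n₁ ∧
      Derivable Γ₂ u P n₂ ∧ Γ = Γ₁ + Γ₂ ∧ n = n₁ + n₂ + 1 := by
  constructor
  · intro h
    cases h with
    | app h₁ h₂ => exact ⟨_, _, _, _, _, h₁, h₂, rfl, rfl⟩
  · rintro ⟨Γ₁, Γ₂, P, n₁, n₂, h₁, h₂, rfl, rfl⟩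
    exact .app h₁ h₂

theorem lam_zero_iff {Γ : Env} {t : Tm} {n : ℕ} :
    Derivable Γ (lam t) 0 n ↔ Γ = 0 ∧ n = 0 := by
  constructor
  · intro h
    generalize hP : (0 : Pos) = P at h
    cases h with
    | lam_nil => exact ⟨rfl, rfl⟩
    | lam_cons => exact absurd hP.symm (Multiset.cons_ne_zero)
  · rintro ⟨rfl, rfl⟩
    exact .lam_nil t

/-- An abstraction with a singleton type has its body typed exactly once. This is why a step inside
an applied abstraction changes the size by the same constant as at the root. -/
theorem lam_singleton_iff {Γ : Env} {t : Tm} {P Q : Pos} {n : ℕ} :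
    Derivable Γ (lam t) {arr P Q} n ↔ Derivable (Env.cons P Γ) t Q n := by
  constructor
  · intro h
    generalize hR : ({arr P Q} : Pos) = R at h
    cases h with
    | lam_nil => exact absurd hR (Multiset.singleton_ne_zero _)
    | lam_cons h₁ h₂ =>
      rw [← Multiset.cons_zero, Multiset.cons_eq_cons] at hR
      rcases hR with ⟨h, rfl⟩ | ⟨-, _, h, -⟩
      swap
      · exact absurd h.symm Multiset.cons_ne_zero
      obtain ⟨rfl, rfl⟩ := arr_inj.1 h
      obtain ⟨rfl, rfl⟩ := lam_zero_iff.1 h₂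
      simpa using h₁
  · intro h
    simpa using lam_cons h (lam_nil t)

theorem lam_add {Γ₁ Γ₂ : Env} {t : Tm} {P₁ P₂ : Pos} {n₁ n₂ : ℕ}
    (h₁ : Derivable Γ₁ (lam t) P₁ n₁) (h₂ : Derivable Γ₂ (lam t) P₂ n₂) :
    Derivable (Γ₁ + Γ₂) (lam t) (P₁ + P₂) (n₁ + n₂) := by
  generalize hs : lam t = s at h₁
  induction h₁ with
  | var => cases hs
  | app => cases hs
  | lam_nil => cases hs; simpa using h₂
  | lam_cons h _ _ ih =>
    cases hs
    rw [Multiset.cons_add, add_assoc, add_assoc]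
    exact lam_cons h (ih rfl)

/-- A derivation for an abstraction is a multiset of derivations of its body, one per arrow, so it
can be distributed over any decomposition of the type. -/
theorem lam_split {Γ : Env} {t : Tm} {P P₁ P₂ : Pos} {n : ℕ} (h : Derivable Γ (lam t) P n)
    (hP : P = P₁ + P₂) : ∃ Γ₁ Γ₂ n₁ n₂, Derivable Γ₁ (lam t) P₁ n₁ ∧
      Derivable Γ₂ (lam t) P₂ n₂ ∧ Γ = Γ₁ + Γ₂ ∧ n = n₁ + n₂ := by
  generalize hs : lam t = s at h
  induction h generalizing P₁ P₂ with
  | var => cases hs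
  | app => cases hs
  | lam_nil =>
    cases hs
    obtain ⟨rfl, rfl⟩ := add_eq_zero.1 hP.symm
    exact ⟨0, 0, 0, 0, lam_nil t, lam_nil t, by simp, rfl⟩
  | @lam_cons Γ Γ' _ P Q R m n h _ _ ih =>
    cases hs
    have hmem : arr P Q ∈ P₁ + P₂ := hP ▸ Multiset.mem_cons_self _ _
    rcases Multiset.mem_add.1 hmem with hm | hm
    · obtain ⟨P', rfl⟩ := Multiset.exists_cons_of_mem hm
      rw [Multiset.cons_add, Multiset.cons_inj_right] at hP
      obtain ⟨Γ₁, Γ₂, n₁, n₂, h₁, h₂, rfl, rfl⟩ := ih hP rfl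
      exact ⟨_, _, _, _, lam_cons h h₁, h₂, (add_assoc _ _ _).symm, (add_assoc _ _ _).symm⟩
    · obtain ⟨P', rfl⟩ := Multiset.exists_cons_of_mem hm
      rw [Multiset.add_cons, Multiset.cons_inj_right] at hP
      obtain ⟨Γ₁, Γ₂, n₁, n₂, h₁, h₂, rfl, rfl⟩ := ih hP rfl
      exact ⟨_, _, _, _, h₁, lam_cons h h₂, add_left_comm _ _ _, add_left_comm _ _ _⟩

theorem lam_cons_iff {Γ : Env} {t : Tm} {P Q R : Pos} {n : ℕ} :
    Derivable Γ (lam t) (arr P Q ::ₘ R) n ↔ ∃ Γ₁ Γ₂ n₁ n₂, Derivable (Env.cons P Γ₁) t Q n₁ ∧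
      Derivable Γ₂ (lam t) R n₂ ∧ Γ = Γ₁ + Γ₂ ∧ n = n₁ + n₂ := by
  constructor
  · intro h
    obtain ⟨Γ₁, Γ₂, n₁, n₂, h₁, h₂, e, e'⟩ := lam_split h (Multiset.singleton_add _ _).symm
    exact ⟨Γ₁, Γ₂, n₁, n₂, lam_singleton_iff.1 h₁, h₂, e, e'⟩
  · rintro ⟨Γ₁, Γ₂, n₁, n₂, h₁, h₂, rfl, rfl⟩
    exact lam_cons h₁ h₂

theorem value_zero_iff {Γ : Env} {v : Tm} (hv : IsValue v) {n : ℕ} :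
    Derivable Γ v 0 n ↔ Γ = 0 ∧ n = 0 := by
  cases hv with
  | var x => rw [var_iff, Pi.single_zero]
  | lam t => exact lam_zero_iff

/-- Specific to values: for an application, splitting would duplicate the final @ rule and break
additivity of sizes. -/
theorem value_add_iff {Γ : Env} {v : Tm} (hv : IsValue v) {P₁ P₂ : Pos} {n : ℕ} :
    Derivable Γ v (P₁ + P₂) n ↔ ∃ Γ₁ Γ₂ n₁ n₂, Derivable Γ₁ v P₁ n₁ ∧ Derivable Γ₂ v P₂ n₂ ∧
      Γ = Γ₁ + Γ₂ ∧ n = n₁ + n₂ := by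
  cases hv with
  | var x =>
    simp only [var_iff]
    constructor
    · rintro ⟨rfl, rfl⟩
      exact ⟨_, _, _, _, ⟨rfl, rfl⟩, ⟨rfl, rfl⟩, Pi.single_add _ _ _, rfl⟩
    · rintro ⟨_, _, _, _, ⟨rfl, rfl⟩, ⟨rfl, rfl⟩, rfl, rfl⟩
      exact ⟨(Pi.single_add _ _ _).symm, rfl⟩
  | lam t =>
    constructor
    · exact fun h => lam_split h rfl
    · rintro ⟨Γ₁, Γ₂, n₁, n₂, h₁, h₂, rfl, rfl⟩
      exact lam_add h₁ h₂

/-! ### Renaming and substitution -/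

theorem rename_iff {t : Tm} {ρ : ℕ → ℕ} (hρ : ρ.Injective) {Γ : Env} {P : Pos} {n : ℕ} :
    Derivable Γ (rename ρ t) P n ↔ ∃ Δ, Γ = ren ρ Δ ∧ Derivable Δ t P n := by
  induction t generalizing ρ Γ P n with
  | var x =>
    simp only [rename, var_iff]
    constructor
    · rintro ⟨rfl, rfl⟩
      exact ⟨_, (ren_single hρ x P).symm, rfl, rfl⟩
    · rintro ⟨_, rfl, rfl, rfl⟩
      exact ⟨ren_single hρ x P, rfl⟩
  | app t u iht ihu =>
    simp only [rename, app_iff, iht hρ, ihu hρ]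
    constructor
    · rintro ⟨_, _, P, n₁, n₂, ⟨Δ₁, rfl, h₁⟩, ⟨Δ₂, rfl, h₂⟩, rfl, rfl⟩
      exact ⟨_, (ren_add _ _ _).symm, _, _, _, _, _, h₁, h₂, rfl, rfl⟩
    · rintro ⟨_, rfl, Δ₁, Δ₂, P, n₁, n₂, h₁, h₂, rfl, rfl⟩
      exact ⟨_, _, _, _, _, ⟨_, rfl, h₁⟩, ⟨_, rfl, h₂⟩, ren_add _ _ _, rfl⟩
  | lam t ih =>
    have hρ' := upRen_injective hρ
    simp only [rename]
    induction P using Multiset.induction generalizing Γ n with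
    | empty =>
      simp only [lam_zero_iff]
      constructor
      · rintro ⟨rfl, rfl⟩
        exact ⟨0, (ren_zero ρ).symm, rfl, rfl⟩
      · rintro ⟨_, rfl, rfl, rfl⟩
        exact ⟨ren_zero ρ, rfl⟩
    | cons N R ihR =>
      obtain ⟨P, Q, rfl⟩ := exists_arr N
      simp only [lam_cons_iff, ihR, ih hρ']
      constructor
      · rintro ⟨Γ₁, _, n₁, n₂, ⟨Δ₁, e, h₁⟩, ⟨Δ₂, rfl, h₂⟩, rfl, rfl⟩
        obtain ⟨P', Δ₁, rfl⟩ := exists_cons Δ₁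
        rw [ren_upRen_cons hρ hρ', cons_inj] at e
        obtain ⟨rfl, rfl⟩ := e
        exact ⟨_, (ren_add _ _ _).symm, _, _, _, _, h₁, h₂, rfl, rfl⟩
      · rintro ⟨_, rfl, Δ₁, Δ₂, n₁, n₂, h₁, h₂, rfl, rfl⟩
        exact ⟨_, _, _, _, ⟨_, (ren_upRen_cons hρ hρ' _ _).symm, h₁⟩, ⟨_, rfl, h₂⟩,
          ren_add _ _ _, rfl⟩

/-- The typing counterpart of "not free": the new variable gets type `0`. -/
theorem shift_iff {t : Tm} {Γ : Env} {P : Pos} {n : ℕ} :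
    Derivable Γ (shift t) P n ↔ ∃ Δ, Γ = Env.cons 0 Δ ∧ Derivable Δ t P n := by
  simp only [shift, rename_iff Nat.succ_injective, ren_succ]

end Derivable

theorem Tm.IsValue.shift {v : Tm} (hv : IsValue v) : IsValue (shift v) := by
  cases hv with
  | var x => exact .var _
  | lam t => exact .lam _

/-- `σ` replaces the variable of index `k` by `w` and lowers the indices above `k`. -/
def Tm.Replaces (σ : ℕ → Tm) (k : ℕ) (w : Tm) : Prop :=
  (∀ x < k, σ x = var x) ∧ σ k = w ∧ ∀ x, k ≤ x → σ (x + 1) = var x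

theorem Tm.Replaces.upSubst {σ : ℕ → Tm} {k : ℕ} {w : Tm} (h : Replaces σ k w) :
    Replaces (upSubst σ) (k + 1) (shift w) := by
  obtain ⟨h₁, h₂, h₃⟩ := h
  refine ⟨fun x hx => ?_, by simp [Tm.upSubst, h₂], fun x hx => ?_⟩
  · cases x with
    | zero => rfl
    | succ x => simp [Tm.upSubst, h₁ x (by omega), Tm.shift, rename]
  · cases x with
    | zero => omega
    | succ x => simp [Tm.upSubst, h₃ x (by omega), Tm.shift, rename]

namespace Derivable

/-- `Δ k` collects the types demanded by the occurrences of the replaced variable. The derivation of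
`w` at that type is the sum of those plugged in at the occurrences, so it splits at each application
and at each premise of an abstraction. -/
theorem subst_iff {t : Tm} {σ : ℕ → Tm} {k : ℕ} {w : Tm} (hσ : Replaces σ k w) (hw : IsValue w)
    {Γ : Env} {P : Pos} {n : ℕ} :
    Derivable Γ (subst σ t) P n ↔ ∃ Δ Θ m₁ m₂, Derivable Δ t P m₁ ∧ Derivable Θ w (Δ k) m₂ ∧
      Γ = del k Δ + Θ ∧ n = m₁ + m₂ := by
  induction t generalizing σ k w Γ P n with
  | var x =>
    simp only [subst, var_iff]
    rcases lt_trichotomy x k with hx | rfl | hx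
    · rw [hσ.1 x hx, var_iff]
      constructor
      · rintro ⟨rfl, rfl⟩
        -- The replaced variable does not occur, so `w` is typed with `0`, at no cost.
        refine ⟨_, 0, _, 0, ⟨rfl, rfl⟩, ?_, by rw [del_single_lt hx, add_zero], rfl⟩
        rw [Pi.single_eq_of_ne hx.ne', value_zero_iff hw]
        exact ⟨rfl, rfl⟩
      · rintro ⟨_, Θ, _, m, ⟨rfl, rfl⟩, h, rfl, rfl⟩
        rw [Pi.single_eq_of_ne hx.ne', value_zero_iff hw] at h
        obtain ⟨rfl, rfl⟩ := h
        exact ⟨by rw [del_single_lt hx, add_zero], rfl⟩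
    · rw [hσ.2.1]
      constructor
      · intro h
        refine ⟨_, Γ, _, n, ⟨rfl, rfl⟩, ?_, by rw [del_single_self, zero_add], by simp⟩
        rwa [Pi.single_eq_same]
      · rintro ⟨_, Θ, _, m, ⟨rfl, rfl⟩, h, rfl, rfl⟩
        rw [Pi.single_eq_same] at h
        rwa [del_single_self, zero_add, zero_add]
    · obtain ⟨x, rfl⟩ : ∃ y, x = y + 1 := ⟨x - 1, by omega⟩
      have hx' : k ≤ x := by omega
      rw [hσ.2.2 x hx', var_iff]
      constructor
      · rintro ⟨rfl, rfl⟩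
        refine ⟨_, 0, _, 0, ⟨rfl, rfl⟩, ?_, by rw [del_single_succ hx', add_zero], rfl⟩
        rw [Pi.single_eq_of_ne hx.ne, value_zero_iff hw]
        exact ⟨rfl, rfl⟩
      · rintro ⟨_, Θ, _, m, ⟨rfl, rfl⟩, h, rfl, rfl⟩
        rw [Pi.single_eq_of_ne hx.ne, value_zero_iff hw] at h
        obtain ⟨rfl, rfl⟩ := h
        exact ⟨by rw [del_single_succ hx', add_zero], rfl⟩
  | app t u iht ihu =>
    simp only [subst, app_iff, iht hσ hw, ihu hσ hw]
    constructor
    · rintro ⟨_, _, P, _, _, ⟨Δ₁, Θ₁, a₁, b₁, h₁, k₁, rfl, rfl⟩,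
        ⟨Δ₂, Θ₂, a₂, b₂, h₂, k₂, rfl, rfl⟩, rfl, rfl⟩
      refine ⟨_, _, _, _, ⟨_, _, _, _, _, h₁, h₂, rfl, rfl⟩,
        (value_add_iff hw).2 ⟨_, _, _, _, k₁, k₂, rfl, rfl⟩, ?_, by omega⟩
      rw [del_add, add_add_add_comm]
    · rintro ⟨_, Θ, _, m, ⟨Δ₁, Δ₂, P, n₁, n₂, h₁, h₂, rfl, rfl⟩, h, rfl, rfl⟩
      obtain ⟨Θ₁, Θ₂, b₁, b₂, k₁, k₂, rfl, rfl⟩ := (value_add_iff hw).1 h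
      refine ⟨_, _, _, _, _, ⟨_, _, _, _, h₁, k₁, rfl, rfl⟩, ⟨_, _, _, _, h₂, k₂, rfl, rfl⟩,
        ?_, by omega⟩
      rw [del_add, add_add_add_comm]
  | lam t ih =>
    simp only [subst]
    induction P using Multiset.induction generalizing Γ n with
    | empty =>
      simp only [lam_zero_iff]
      constructor
      · rintro ⟨rfl, rfl⟩
        exact ⟨0, 0, 0, 0, ⟨rfl, rfl⟩, (value_zero_iff hw).2 ⟨rfl, rfl⟩, by simp [del_zero], rfl⟩
      · rintro ⟨_, Θ, _, m, ⟨rfl, rfl⟩, h, rfl, rfl⟩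
        obtain ⟨rfl, rfl⟩ := (value_zero_iff hw).1 h
        exact ⟨by simp [del_zero], rfl⟩
    | cons N R ihR =>
      obtain ⟨P, Q, rfl⟩ := exists_arr N
      simp only [lam_cons_iff, ihR, ih hσ.upSubst hw.shift, shift_iff]
      constructor
      · rintro ⟨Γ₁, _, _, _, ⟨Δ₁, _, a₁, b₁, h₁, ⟨Θ₁, rfl, k₁⟩, e, rfl⟩,
          ⟨Δ₂, Θ₂, a₂, b₂, h₂, k₂, rfl, rfl⟩, rfl, rfl⟩
        obtain ⟨P', Δ₁, rfl⟩ := exists_cons Δ₁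
        rw [del_succ_cons, cons_add, cons_inj, add_zero] at e
        obtain ⟨rfl, rfl⟩ := e
        refine ⟨_, _, _, _, ⟨_, _, _, _, h₁, h₂, rfl, rfl⟩,
          (value_add_iff hw).2 ⟨_, _, _, _, k₁, k₂, rfl, rfl⟩, ?_, by omega⟩
        rw [del_add, add_add_add_comm]
      · rintro ⟨_, Θ, _, m, ⟨Δ₁, Δ₂, n₁, n₂, h₁, h₂, rfl, rfl⟩, h, rfl, rfl⟩
        obtain ⟨Θ₁, Θ₂, b₁, b₂, k₁, k₂, rfl, rfl⟩ := (value_add_iff hw).1 h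
        refine ⟨del k Δ₁ + Θ₁, _, _, _, ⟨_, _, _, _, h₁, ⟨Θ₁, rfl, k₁⟩, ?_, rfl⟩,
          ⟨_, _, _, _, h₂, k₂, rfl, rfl⟩, ?_, by omega⟩
        · rw [del_succ_cons, cons_add, add_zero]
        · rw [del_add, add_add_add_comm]

theorem inst_iff {t v : Tm} (hv : IsValue v) {Γ : Env} {P : Pos} {n : ℕ} :
    Derivable Γ (inst t v) P n ↔ ∃ Q Δ Θ m₁ m₂, Derivable (Env.cons Q Δ) t P m₁ ∧
      Derivable Θ v Q m₂ ∧ Γ = Δ + Θ ∧ n = m₁ + m₂ := by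
  rw [inst, subst_iff (k := 0) (w := v) ⟨by simp, rfl, fun _ _ => rfl⟩ hv]
  constructor
  · rintro ⟨Δ, Θ, m₁, m₂, h₁, h₂, rfl, rfl⟩
    obtain ⟨Q, Δ, rfl⟩ := exists_cons Δ
    exact ⟨_, _, _, _, _, h₁, h₂, by rw [del_zero_cons], rfl⟩
  · rintro ⟨Q, Δ, Θ, m₁, m₂, h₁, h₂, rfl, rfl⟩
    exact ⟨_, _, _, _, h₁, h₂, by rw [del_zero_cons], rfl⟩

end Derivable

/-! ### Derivations along reduction -/

/-- `t` and `u` have the same typings, with derivations of `t` larger by `c`. -/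
def SameTypings (c : ℕ) (t u : Tm) : Prop :=
  ∀ Γ P n, Derivable Γ t P n ↔ ∃ m, n = m + c ∧ Derivable Γ u P m

open Derivable

/-- Both sides decompose into the same two derivations, of the body and of the argument; the
difference is the @ rule of the redex. -/
theorem RootBetaV.sameTypings {t u : Tm} (h : RootBetaV t u) : SameTypings 1 t u := by
  obtain ⟨t, v, hv⟩ := h
  intro Γ P n
  simp only [app_iff, inst_iff hv, lam_singleton_iff]
  constructor
  · rintro ⟨Δ, Θ, Q, m₁, m₂, h₁, h₂, rfl, rfl⟩
    exact ⟨_, rfl, _, _, _, _, _, h₁, h₂, rfl, rfl⟩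
  · rintro ⟨_, rfl, Q, Δ, Θ, m₁, m₂, h₁, h₂, rfl, rfl⟩
    exact ⟨_, _, _, _, _, h₁, h₂, rfl, rfl⟩

/-- The same three subderivations are joined by two @ rules on either side; only the bracketing of
the environments changes. -/
theorem RootSigma.sameTypings {t u : Tm} (h : RootSigma t u) : SameTypings 0 t u := by
  intro Γ P n
  cases h with
  | sigma1 t u s =>
    simp only [app_iff, lam_singleton_iff, shift_iff]
    constructor
    · rintro ⟨_, Γ₃, Q, _, n₃, ⟨Γ₁, Γ₂, R, n₁, n₂, h₁, h₂, rfl, rfl⟩, h₃, rfl, rfl⟩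
      refine ⟨_, rfl, Γ₁ + Γ₃, Γ₂, R, _, _, ⟨_, _, _, _, _, h₁, ⟨_, rfl, h₃⟩, ?_, rfl⟩, h₂,
        add_right_comm _ _ _, by omega⟩
      rw [cons_add, add_zero]
    · rintro ⟨_, rfl, Γ', Γ₂, R, _, n₂, ⟨Γ₁, _, Q, n₁, n₃, h₁, ⟨Γ₃, rfl, h₃⟩, e, rfl⟩, h₂,
        rfl, rfl⟩
      obtain ⟨R', Γ₁, rfl⟩ := exists_cons Γ₁
      rw [cons_add, add_zero, cons_inj] at e
      obtain ⟨rfl, rfl⟩ := e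
      exact ⟨_, _, _, _, _, ⟨_, _, _, _, _, h₁, h₂, rfl, rfl⟩, h₃, add_right_comm _ _ _,
        by omega⟩
  | sigma3 v s u hv =>
    simp only [app_iff, lam_singleton_iff, shift_iff]
    constructor
    · rintro ⟨Γ₁, _, Q, n₁, _, h₁, ⟨Γ₂, Γ₃, R, n₂, n₃, h₂, h₃, rfl, rfl⟩, rfl, rfl⟩
      refine ⟨_, rfl, Γ₁ + Γ₂, Γ₃, R, _, _, ⟨_, _, _, _, _, ⟨_, rfl, h₁⟩, h₂, ?_, rfl⟩, h₃,
        (add_assoc _ _ _).symm, by omega⟩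
      rw [cons_add, zero_add]
    · rintro ⟨_, rfl, Γ', Γ₃, R, _, n₃, ⟨_, Γ₂, Q, n₁, n₂, ⟨Γ₁, rfl, h₁⟩, h₂, e, rfl⟩, h₃,
        rfl, rfl⟩
      obtain ⟨R', Γ₂, rfl⟩ := exists_cons Γ₂
      rw [cons_add, zero_add, cons_inj] at e
      obtain ⟨rfl, rfl⟩ := e
      exact ⟨_, _, _, _, _, h₁, ⟨_, _, _, _, _, h₂, h₃, rfl, rfl⟩, add_assoc _ _ _, by omega⟩

theorem SameTypings.appL {c : ℕ} {t u : Tm} (h : SameTypings c t u) (s : Tm) :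
    SameTypings c (app t s) (app u s) := by
  intro Γ P n
  simp only [app_iff]
  constructor
  · rintro ⟨Γ₁, Γ₂, Q, n₁, n₂, h₁, h₂, rfl, rfl⟩
    obtain ⟨m, rfl, h₁'⟩ := (h _ _ _).1 h₁
    exact ⟨m + n₂ + 1, by omega, _, _, _, _, _, h₁', h₂, rfl, rfl⟩
  · rintro ⟨_, rfl, Γ₁, Γ₂, Q, n₁, n₂, h₁, h₂, rfl, rfl⟩
    exact ⟨_, _, _, _, _, (h _ _ _).2 ⟨_, rfl, h₁⟩, h₂, rfl, by omega⟩

theorem SameTypings.appR {c : ℕ} {t u : Tm} (h : SameTypings c t u) (s : Tm) :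
    SameTypings c (app s t) (app s u) := by
  intro Γ P n
  simp only [app_iff]
  constructor
  · rintro ⟨Γ₁, Γ₂, Q, n₁, n₂, h₁, h₂, rfl, rfl⟩
    obtain ⟨m, rfl, h₂'⟩ := (h _ _ _).1 h₂
    exact ⟨n₁ + m + 1, by omega, _, _, _, _, _, h₁, h₂', rfl, rfl⟩
  · rintro ⟨_, rfl, Γ₁, Γ₂, Q, n₁, n₂, h₁, h₂, rfl, rfl⟩
    exact ⟨_, _, _, _, _, h₁, (h _ _ _).2 ⟨_, rfl, h₂⟩, rfl, by omega⟩

theorem SameTypings.lamApp {c : ℕ} {t u : Tm} (h : SameTypings c t u) (s : Tm) :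
    SameTypings c (app (lam t) s) (app (lam u) s) := by
  intro Γ P n
  simp only [app_iff, lam_singleton_iff]
  constructor
  · rintro ⟨Γ₁, Γ₂, Q, n₁, n₂, h₁, h₂, rfl, rfl⟩
    obtain ⟨m, rfl, h₁'⟩ := (h _ _ _).1 h₁
    exact ⟨m + n₂ + 1, by omega, _, _, _, _, _, h₁', h₂, rfl, rfl⟩
  · rintro ⟨_, rfl, Γ₁, Γ₂, Q, n₁, n₂, h₁, h₂, rfl, rfl⟩
    exact ⟨_, _, _, _, _, (h _ _ _).2 ⟨_, rfl, h₁⟩, h₂, rfl, by omega⟩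

theorem SameTypings.fill {c : ℕ} {t u : Tm} (h : SameTypings c t u) (B : BCtx) :
    SameTypings c (B.fill t) (B.fill u) := by
  induction B with
  | hole => exact h
  | lamApp B s ih => exact ih.lamApp s
  | appL B s ih => exact ih.appL s
  | appR s B ih => exact ih.appR s

theorem BetaV.sameTypings {t u : Tm} (h : BetaV t u) : SameTypings 1 t u := by
  obtain ⟨B, t, u, rfl, rfl, h⟩ := h
  exact h.sameTypings.fill B

theorem Sigma.sameTypings {t u : Tm} (h : Sigma t u) : SameTypings 0 t u := by
  obtain ⟨B, t, u, rfl, rfl, h⟩ := h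
  exact h.sameTypings.fill B

theorem ShufSeq.sameTypings {t u : Tm} (d : ShufSeq t u) : SameTypings d.leng t u := by
  induction d with
  | nil t => intro Γ P n; simp [ShufSeq.leng]
  | betaV h d ih =>
    intro Γ P n
    rw [h.sameTypings Γ P n]
    simp only [ih Γ P, ShufSeq.leng]
    constructor
    · rintro ⟨_, rfl, m, rfl, h⟩
      exact ⟨m, rfl, h⟩
    · rintro ⟨m, rfl, h⟩
      exact ⟨_, rfl, m, rfl, h⟩
  | sigma h d ih =>
    intro Γ P n
    rw [h.sameTypings Γ P n]
    simp only [add_zero, exists_eq_left', ih Γ P, ShufSeq.leng]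

/-- A reduction sequence of balanced `βv`-steps as a balanced shuffling one. -/
def BetaVSeq.toShufSeq : {t u : Tm} → BetaVSeq t u → ShufSeq t u
  | _, _, nil t => .nil t
  | _, _, cons h d => .betaV h d.toShufSeq

theorem BetaVSeq.leng_toShufSeq {t u : Tm} (d : BetaVSeq t u) :
    d.toShufSeq.leng = d.leng := by
  induction d with
  | nil t => rfl
  | cons h d ih => simp only [toShufSeq, ShufSeq.leng, BetaVSeq.leng, ih]

theorem BetaVSeq.nonempty_of_reflTransGen {t u : Tm} (h : Relation.ReflTransGen BetaV t u) :
    Nonempty (BetaVSeq t u) := by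
  induction h using Relation.ReflTransGen.head_induction_on with
  | refl => exact ⟨.nil u⟩
  | head h _ ih => exact ih.map (.cons h)

/-! ### Normal forms -/

theorem BetaV.appL {t u : Tm} (h : BetaV t u) (s : Tm) : BetaV (app t s) (app u s) := by
  obtain ⟨B, t, u, rfl, rfl, h⟩ := h
  exact ⟨.appL B s, t, u, rfl, rfl, h⟩

theorem BetaV.appR {t u : Tm} (h : BetaV t u) (s : Tm) : BetaV (app s t) (app s u) := by
  obtain ⟨B, t, u, rfl, rfl, h⟩ := h
  exact ⟨.appR s B, t, u, rfl, rfl, h⟩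

theorem Normal.appL {t s : Tm} (h : Normal BetaV (app t s)) : Normal BetaV t :=
  fun _ hu => h _ (hu.appL s)

theorem Normal.appR {t s : Tm} (h : Normal BetaV (app s t)) : Normal BetaV t :=
  fun _ hu => h _ (hu.appR s)

theorem not_normal_app_lam {t v : Tm} (hv : IsValue v) : ¬ Normal BetaV (app (lam t) v) :=
  fun h => h _ ⟨.hole, _, _, rfl, rfl, .mk t v hv⟩

theorem Normal.betaV {t : Tm} (h : Normal Shuf t) : Normal BetaV t := by
  rintro u ⟨B, t', u', ht, hu, hr⟩
  exact h u ⟨B, t', u', ht, hu, .inl hr⟩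

/-- Balanced contexts enter an abstraction only if it is applied. -/
theorem normal_shuf_lam (t : Tm) : Normal Shuf (lam t) := by
  rintro u ⟨B, t', u', ht, -, hr⟩
  cases B with
  | hole =>
    cases ht
    rcases hr with hr | hr <;> cases hr
  | _ => cases ht

/-- In an application both parts would be values by induction; the function part has a nonzero type
in the empty environment, so it is an abstraction and there is a redex. Typability replaces
closedness here, so free variables need not be tracked along `σ`-steps. -/
theorem Normal.isValue_of_derivable {t : Tm} (ht : Normal BetaV t) {P : Pos} {n : ℕ}
    (h : Derivable 0 t P n) : IsValue t := by
  induction t generalizing P n with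
  | var x => exact .var x
  | lam t => exact .lam t
  | app t u iht ihu =>
    obtain ⟨Γ₁, Γ₂, Q, n₁, n₂, h₁, h₂, e, -⟩ := app_iff.1 h
    obtain ⟨rfl, rfl⟩ := add_eq_zero.1 e.symm
    have hu := ihu ht.appR h₂
    cases iht ht.appL h₁ with
    | var x =>
      have := congrFun (var_iff.1 h₁).1 x
      rw [Pi.single_eq_same] at this
      exact absurd this.symm (Multiset.singleton_ne_zero _)
    | lam t => exact absurd ht (not_normal_app_lam hu)

theorem Normal.eq_lam_of_closed {t : Tm} (ht : Normal BetaV t) (hc : t.Closed) :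
    ∃ s, t = lam s := by
  induction t with
  | var x => exact absurd hc (Set.singleton_ne_empty x)
  | lam t => exact ⟨t, rfl⟩
  | app t u iht ihu =>
    obtain ⟨h₁, h₂⟩ := Set.union_empty_iff.1 hc
    obtain ⟨t, rfl⟩ := iht ht.appL h₁
    obtain ⟨u, rfl⟩ := ihu ht.appR h₂
    exact absurd ht (not_normal_app_lam (.lam u))

/-! ### Free variables along reduction -/

theorem Tm.mem_freeVars_rename {t : Tm} {ρ : ℕ → ℕ} {y : ℕ} (h : y ∈ (rename ρ t).freeVars) :
    ∃ x ∈ t.freeVars, ρ x = y := by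
  induction t generalizing ρ y with
  | var x => exact ⟨x, rfl, Eq.symm h⟩
  | app t u iht ihu =>
    rcases h with h | h
    · obtain ⟨x, hx, e⟩ := iht h
      exact ⟨x, .inl hx, e⟩
    · obtain ⟨x, hx, e⟩ := ihu h
      exact ⟨x, .inr hx, e⟩
  | lam t ih =>
    obtain ⟨x, hx, e⟩ := ih h
    cases x with
    | zero => simp [upRen] at e
    | succ x => exact ⟨x, hx, Nat.succ_injective e⟩

theorem Tm.mem_freeVars_subst {t : Tm} {σ : ℕ → Tm} {y : ℕ} (h : y ∈ (subst σ t).freeVars) :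
    ∃ x ∈ t.freeVars, y ∈ (σ x).freeVars := by
  induction t generalizing σ y with
  | var x => exact ⟨x, rfl, h⟩
  | app t u iht ihu =>
    rcases h with h | h
    · obtain ⟨x, hx, e⟩ := iht h
      exact ⟨x, .inl hx, e⟩
    · obtain ⟨x, hx, e⟩ := ihu h
      exact ⟨x, .inr hx, e⟩
  | lam t ih =>
    obtain ⟨x, hx, e⟩ := ih h
    cases x with
    | zero => exact absurd e (Nat.succ_ne_zero y)
    | succ x =>
      obtain ⟨z, hz, e⟩ := mem_freeVars_rename e
      exact ⟨x, hx, Nat.succ_injective e ▸ hz⟩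

theorem RootBetaV.freeVars_subset {t u : Tm} (h : RootBetaV t u) :
    u.freeVars ⊆ t.freeVars := by
  obtain ⟨t, v, -⟩ := h
  intro y hy
  obtain ⟨x, hx, hy⟩ := mem_freeVars_subst hy
  cases x with
  | zero => exact .inr hy
  | succ x => exact .inl (show y + 1 ∈ t.freeVars from (show y = x from hy) ▸ hx)

theorem BCtx.freeVars_fill_subset {t u : Tm} (h : u.freeVars ⊆ t.freeVars) (B : BCtx) :
    (B.fill u).freeVars ⊆ (B.fill t).freeVars := by
  induction B with
  | hole => exact h
  | lamApp B s ih => exact Set.union_subset_union_left _ fun _ hx => ih hx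
  | appL B s ih => exact Set.union_subset_union_left _ ih
  | appR s B ih => exact Set.union_subset_union_right _ ih

theorem BetaV.closed {t u : Tm} (h : BetaV t u) (ht : t.Closed) : u.Closed := by
  obtain ⟨B, t, u, rfl, rfl, h⟩ := h
  exact Set.subset_eq_empty (B.freeVars_fill_subset h.freeVars_subset) ht

theorem closed_of_reflTransGen_betaV {t u : Tm} (h : Relation.ReflTransGen BetaV t u)
    (ht : t.Closed) : u.Closed := by
  induction h with
  | refl => exact ht
  | tail _ h ih => exact h.closed ih

theorem ShufSeq.leng_eq_size {t u : Tm} (d : ShufSeq t u) (hu : Normal BetaV u)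
    (π : Deriv 0 t 0) : d.leng = π.size := by
  obtain ⟨m, hm, h⟩ := (d.sameTypings _ _ _).1 π.derivable
  have := ((value_zero_iff (hu.isValue_of_derivable h)).1 h).2
  omega

end CbV

open CbV in
theorem mainTheorem9 (t : Tm) (hc : t.Closed) (hn : Normalizable BetaV t) :
    Nonempty (Deriv 0 t 0) ∧
    ∀ π : Deriv 0 t 0,
      leng t = (π.size : ℕ∞) ∧
      (∀ (t₀ : Tm) (d : ShufSeq t t₀), Normal Shuf t₀ → d.leng = π.size) ∧
      (∀ (t₀ : Tm) (d : BetaVSeq t t₀), Normal BetaV t₀ → d.leng = π.size) := by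
  obtain ⟨u, hu, hnu⟩ := hn
  obtain ⟨s, rfl⟩ := hnu.eq_lam_of_closed (closed_of_reflTransGen_betaV hu hc)
  obtain ⟨d⟩ := BetaVSeq.nonempty_of_reflTransGen hu
  refine ⟨?_, fun π => ⟨le_antisymm ?_ ?_, fun t₀ d h => d.leng_eq_size h.betaV π, fun t₀ d h => ?_⟩⟩
  · obtain ⟨π, -⟩ :=
      ((d.toShufSeq.sameTypings 0 0 _).2 ⟨0, rfl, Derivable.lam_nil s⟩).exists_deriv
    exact ⟨π⟩
  -- The `βv`-normal form reached is an abstraction, hence also normal for shuffling, so the infimum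
  -- is over a nonempty set.
  · refine sInf_le ⟨_, d.toShufSeq, normal_shuf_lam s, ?_⟩
    rw [d.toShufSeq.leng_eq_size hnu π]
  · refine le_sInf ?_
    rintro _ ⟨u, d, h, rfl⟩
    rw [d.leng_eq_size h.betaV π]
  · rw [← d.leng_toShufSeq, d.toShufSeq.leng_eq_size h π]
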